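/- **Theorem 3.12 (Stationary algorithmic computer probability).** A *computer* is a partial recursive function $C:\{0,1\}^*\to\{0,1\}^*$; computers are identified if they agree as partial functions, and $\Xi$ is the set of all computers. For $C\in\Xi$ and $x\in\{0,1\}^*$ let $C_x\in\Xi$ be the computer $C_x(s)=C(x\otimes s)$, where $\otimes$ is concatenation of strings. We say that $C$ *emulates* $D$ via $x$ if $C_x=D$. A set $\Phi\subset\Xi$ is *branching* if for every $C\in\Phi$: (i) $C_{x\otimes y}\in\Phi$ implies $C_x\in\Phi$ for all $x,y\in\{0,1\}^*$; (ii) $C_x\in\Phi$ for some nonempty string $x$. For branching $\Phi$ and $C\in\Phi$, put $C^{-1}(\Phi)=\{x\in\{0,1\}^* : C_x\in\Phi\}$. The *path probability* of the empty string $\lambda$ is $\mu_{C^{-1}(\Phi)}(\lambda)=1$ and, for a string $x$ and a bit $b$ with $x\otimes b\in C^{-1}(\Phi)$, the value $\mu_{C^{-1}(\Phi)}(x\otimes b)$ is $\frac12\mu_{C^{-1}(\Phi)}(x)$ if $x\otimes\bar b\in C^{-1}(\Phi)$ and $\mu_{C^{-1}(\Phi)}(x)$ otherwise, where $\bar b$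 is the inverse bit. For $C,D\in\Phi$ and $n\ge 0$ let $$\mu_C^{(n)}(D|\Phi)=\sum_{x\in\{0,1\}^n,\;C_x=D}\mu_{C^{-1}(\Phi)}(x).$$ The *emulation matrix* is $E_\Phi=\big(\mu_C^{(1)}(D|\Phi)\big)_{C,D\in\Phi}$; it is the transition matrix of a Markov chain on $\Phi$. The set $\Phi$ is *irreducible* if for all $C,D\in\Phi$ there is $n\ge 0$ with $\mu_C^{(n)}(D|\Phi)>0$, and *aperiodic* if $\gcd\{n\ge1 : \mu_C^{(n)}(C|\Phi)>0\}=1$ for every $C\in\Phi$. The chain is *transient* if from every state the probability of returning to it is less than $1$, *null recurrent* if from every state the return is almost sure with infinite expected return time, and *positive recurrent* if from every state the return is almost sure with finite expected return time. Let $\Phi\subset\Xi$ be nonempty, branching, irreducible and aperiodic. Then for all $C,D\in\Phi$ the limit $$\mu(D|\Phi)=\lim_{n\to\infty}\mu_C^{(n)}(D|\Phi)$$ exists and does not depend on $C$. Moreover the chain is transient, null recurrent or positive recurrent, and: 1. if it is transient or null recurrent, then $\mu(D|\Phi)=0$ for every $D\in\Phi$; 2. if it is positive recurrent, then $\mu(D|\Phi)>0$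 for every $D\in\Phi$ and $\sum_{D\in\Phi}\mu(D|\Phi)=1$; and $\big(\mu(D|\Phi)\big)_{D\in\Phi}$ is the unique stationary probability vector of $E_\Phi$, i.e. the unique vector $\nu=(\nu_D)_{D\in\Phi}$ with nonnegative entries, $\sum_{D\in\Phi}\nu_D=1$ and $\nu E_\Phi=\nu$. -/

import Mathlib

open Filter Topology
open scoped ENNReal

namespace AlgProb

/-- A computer: a partial recursive function from finite binary strings to finite binary strings.
Computers are compared extensionally, as partial functions. -/
def Computer : Type := {f : List Bool →. List Bool // Partrec f}

/-- `C` emulates `D` via `x`: `C (x ⊗ s) = D s` for every string `s`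
(both sides undefined or both defined and equal). -/
def Emulates (C : Computer) (x : List Bool) (D : Computer) : Prop :=
  ∀ s : List Bool, C.1 (x ++ s) = D.1 s

/-- The computer emulated by `C` via `x`, i.e. `s ↦ C (x ⊗ s)`. -/
def Computer.after (C : Computer) (x : List Bool) : Computer :=
  ⟨fun s => C.1 (x ++ s),
    C.2.comp (Primrec.list_append.to_comp.comp (Computable.const x) Computable.id)⟩

theorem emulates_iff (C : Computer) (x : List Bool) (D : Computer) :
    Emulates C x D ↔ C.after x = D := by
  constructor
  · intro h
    exact Subtype.ext (funext h)
  · rintro rfl s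
    rfl

/-- The `Φ`-tree of `C`: all inputs that make `C` emulate a computer in `Φ`. -/
def tree (Φ : Set Computer) (C : Computer) : Set (List Bool) :=
  {x | C.after x ∈ Φ}

/-- Branching sets of computers. -/
def Branching (Φ : Set Computer) : Prop :=
  ∀ C ∈ Φ,
    (∀ x y : List Bool, C.after (x ++ y) ∈ Φ → C.after x ∈ Φ) ∧
    (∃ x : List Bool, x ≠ [] ∧ C.after x ∈ Φ)

open Classical in
/-- The path probability of the reversal of a string (so that the head of the list is the
bit that was read last). -/
noncomputable def pathProbRev (Φ : Set Computer) (C : Computer) : List Bool → ℝ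
  | [] => 1
  | b :: r =>
    if r.reverse ++ [b] ∈ tree Φ C then
      if r.reverse ++ [!b] ∈ tree Φ C then 1 / 2 * pathProbRev Φ C r else pathProbRev Φ C r
    else 0

/-- The path probability of `x` in the `Φ`-tree of `C`: the probability that the random walk on
the tree, started at its root, passes through `x`. Nonempty strings outside of the tree get the
value `0`. See `pathProb_nil` and `pathProb_concat` for the recursion. -/
noncomputable def pathProb (Φ : Set Computer) (C : Computer) (x : List Bool) : ℝ :=
  pathProbRev Φ C x.reverse

theorem pathProb_nil (Φ : Set Computer) (C : Computer) : pathProb Φ C [] = 1 := by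
  simp [pathProb, pathProbRev]

open Classical in
theorem pathProb_concat (Φ : Set Computer) (C : Computer) (x : List Bool) (b : Bool)
    (h : x ++ [b] ∈ tree Φ C) :
    pathProb Φ C (x ++ [b]) =
      if x ++ [!b] ∈ tree Φ C then 1 / 2 * pathProb Φ C x else pathProb Φ C x := by
  simp [pathProb, pathProbRev, h]

open Classical in
/-- The `n`-step computer probability `μ_C^{(n)}(D | Φ)`: the sum of the path probabilities of all
bit strings `x` of length `n` via which `C` emulates `D`. -/
noncomputable def stepProb (Φ : Set Computer) (n : ℕ) (C D : Computer) : ℝ :=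
  ∑ x : Fin n → Bool with Emulates C (List.ofFn x) D, pathProb Φ C (List.ofFn x)

/-- The emulation matrix `E_Φ`, with rows and columns indexed by the computers in `Φ`. -/
noncomputable def emulationMatrix (Φ : Set Computer) : Matrix Φ Φ ℝ :=
  fun C D => stepProb Φ 1 C.1 D.1

/-- Irreducibility of the chain: every computer in `Φ` is reached from every computer in `Φ`, in
some number of steps, with positive probability. -/
def Irreducible (Φ : Set Computer) : Prop :=
  ∀ C ∈ Φ, ∀ D ∈ Φ, ∃ n : ℕ, 0 < stepProb Φ n C D

/-- The period of a computer: the greatest common divisor of all possible return times.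
If there is no possible return time, the value is `0` (in place of `∞`). -/
noncomputable def period (Φ : Set Computer) (C : Computer) : ℕ :=
  Nat.setGcd {n : ℕ | 1 ≤ n ∧ 0 < stepProb Φ n C C}

/-- Aperiodicity: every computer in `Φ` has period one. -/
def Aperiodic (Φ : Set Computer) : Prop :=
  ∀ C ∈ Φ, period Φ C = 1

section MarkovChain

/-! Vocabulary for the Markov chain on a state space `ι` with transition matrix `P`. -/

variable {ι : Type*}

/-- `firstPassage P j n i` is the probability that the Markov chain with transition matrix `P`,
started in state `i`, visits `j` at time `n` but at none of the times `1, …, n - 1`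
(for `n ≥ 1`; the value at `n = 0` is `0`). -/
noncomputable def firstPassage (P : Matrix ι ι ℝ) (j : ι) : ℕ → ι → ℝ
  | 0, _ => 0
  | 1, i => P i j
  | n + 2, i => ∑' k : {k : ι // k ≠ j}, P i k.1 * firstPassage P j (n + 1) k.1

/-- The probability that the chain, started in `i`, ever returns to `i`. -/
noncomputable def returnProb (P : Matrix ι ι ℝ) (i : ι) : ℝ≥0∞ :=
  ∑' n : ℕ, ENNReal.ofReal (firstPassage P i n i)

/-- `∑ n, n * f n`, where `f n` is the probability that the first return to `i` happens at time
`n`. This is the expected return time if the return to `i` is almost sure. -/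
noncomputable def meanReturnTime (P : Matrix ι ι ℝ) (i : ι) : ℝ≥0∞ :=
  ∑' n : ℕ, (n : ℝ≥0∞) * ENNReal.ofReal (firstPassage P i n i)

/-- All states are transient. -/
def IsTransient (P : Matrix ι ι ℝ) : Prop :=
  ∀ i, returnProb P i < 1

/-- All states are null recurrent: the return is almost sure, the expected return time infinite. -/
def IsNullRecurrent (P : Matrix ι ι ℝ) : Prop :=
  ∀ i, returnProb P i = 1 ∧ meanReturnTime P i = ∞

/-- All states are positive recurrent: the return is almost sure, the expected return time
finite. -/
def IsPositiveRecurrent (P : Matrix ι ι ℝ) : Prop :=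
  ∀ i, returnProb P i = 1 ∧ meanReturnTime P i < ∞

/-- `ν` is a stationary probability vector of `P`: it is a probability vector with `ν P = ν`. -/
structure IsStationaryProbVector (P : Matrix ι ι ℝ) (ν : ι → ℝ) : Prop where
  nonneg : ∀ i, 0 ≤ ν i
  hasSum_one : HasSum ν 1
  stationary : ∀ j, HasSum (fun i => ν i * P i j) (ν j)

end MarkovChain

end AlgProb

/-! Path probabilities are multiplicative, since the tree of `C.after x` is the part of the tree of
`C` above `x`. Hence `stepProb` gives the powers of `emulationMatrix`, which is row-stochastic
because `Φ` is branching, and the claim becomes the convergence theorem for an irreducible aperiodic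
chain.

The return probabilities of a state form a renewal sequence whose weights are its first return
probabilities. The limsup and liminf of such a sequence are extremal cluster points. By compactness
and a maximum principle, each is also the limit of all large shifts along an ultrafilter, and the
identity `sum_waitingTail_mul` then forces the value 1/(mean waiting time), read as 0 if the mean is
infinite. For a transient state the return probabilities are summable, so they tend to 0.

Other initial states follow from the first passage decomposition. The limit is a bounded harmonic
function of the initial state, maximal at the target, hence constant by irreducibility.
Stationarity, total mass 1 and uniqueness come from passing to the limit in `ν = ν Pⁿ` and from
Fatou-type bounds. -/

namespace AlgProb

/-! ### Renewal sequences and the renewal theorem -/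

/-- The renewal equation: `u` is the sequence of renewal probabilities of a renewal process whose
waiting time is `k + 1` with probability `g k` (the waiting time may be infinite). -/
structure IsRenewal (g u : ℕ → ℝ) : Prop where
  weight_nonneg : ∀ k, 0 ≤ g k
  nonneg : ∀ n, 0 ≤ u n
  le_one : ∀ n, u n ≤ 1
  zero : u 0 = 1
  succ : ∀ n, u (n + 1) = ∑ k ∈ Finset.range (n + 1), g k * u (n - k)

/-- The probability that the waiting time exceeds `k`. -/
noncomputable def waitingTail (g : ℕ → ℝ) (k : ℕ) : ℝ :=
  1 - ∑ l ∈ Finset.range k, g l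

theorem waitingTail_zero (g : ℕ → ℝ) : waitingTail g 0 = 1 := by
  simp [waitingTail]

theorem waitingTail_succ (g : ℕ → ℝ) (k : ℕ) :
    waitingTail g (k + 1) = waitingTail g k - g k := by
  simp only [waitingTail, Finset.sum_range_succ]
  ring

/-- A bounded solution of `w j = ∑ k, g k * w (j + k + 1)` that attains its maximum at `0` is
eventually constant if the weights `g` are aperiodic. -/
theorem eventually_const_of_weighted_average {g w : ℕ → ℝ} {B : ℝ} (hg : ∀ k, 0 ≤ g k)
    (hg1 : HasSum g 1) (hgcd : Nat.setGcd {n | ∃ k, n = k + 1 ∧ 0 < g k} = 1)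
    (hB : ∀ j, |w j| ≤ B) (hw : ∀ j, w j = ∑' k, g k * w (j + k + 1)) (hmax : ∀ j, w j ≤ w 0) :
    ∃ J, ∀ j ≥ J, w j = w 0 := by
  -- Maximum principle: an average of values at most `w 0` equals `w 0` only if every value of
  -- positive weight does.
  have step : ∀ j, w j = w 0 → ∀ k, 0 < g k → w (j + k + 1) = w 0 := by
    intro j hj k hk
    have hs : Summable fun k => g k * w (j + k + 1) := by
      refine Summable.of_norm_bounded (hg1.summable.mul_right B) fun k => ?_
      rw [norm_mul, Real.norm_of_nonneg (hg k)]
      exact mul_le_mul_of_nonneg_left (hB _) (hg k)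
    have h0 : HasSum (fun k => g k * (w 0 - w (j + k + 1))) 0 := by
      have := (hg1.mul_right (w 0)).sub hs.hasSum
      rw [← hw j, hj, one_mul, sub_self] at this
      simpa [mul_sub] using this
    have h1 := (hasSum_zero_iff_of_nonneg
      (fun k => mul_nonneg (hg k) (sub_nonneg.2 (hmax _)))).1 h0
    have h2 := congrFun h1 k
    simp only [Pi.zero_apply, mul_eq_zero, hk.ne', false_or] at h2
    linarith
  have hmem : ∀ x ∈ AddSubmonoid.closure {n | ∃ k, n = k + 1 ∧ 0 < g k},
      ∀ j, w j = w 0 → w (j + x) = w 0 := by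
    intro x hx
    induction hx using AddSubmonoid.closure_induction with
    | mem x hx =>
      obtain ⟨k, rfl, hk⟩ := hx
      intro j hj
      exact step j hj k hk
    | zero => intro j hj; simpa using hj
    | add x y _ _ hx hy =>
      intro j hj
      rw [← add_assoc]
      exact hy _ (hx j hj)
  -- An additive semigroup of naturals with gcd 1 contains all large integers.
  obtain ⟨J, hJ⟩ := Nat.exists_mem_closure_of_ge {n | ∃ k, n = k + 1 ∧ 0 < g k}
  refine ⟨J, fun j hj => ?_⟩
  have := hmem j (hJ j hj (by rw [hgcd]; exact one_dvd _)) 0 rfl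
  simpa using this

namespace IsRenewal

variable {g u : ℕ → ℝ}

/-- Split according to the last renewal up to time `n`: it occurs at `n - k`, and the next waiting
time exceeds `k`. -/
theorem sum_waitingTail_mul (h : IsRenewal g u) (n : ℕ) :
    ∑ k ∈ Finset.range (n + 1), waitingTail g k * u (n - k) = 1 := by
  induction n with
  | zero => simp [waitingTail_zero, h.zero]
  | succ n ih =>
    rw [Finset.sum_range_succ']
    have : ∀ k ∈ Finset.range (n + 1), waitingTail g (k + 1) * u (n + 1 - (k + 1))
        = waitingTail g k * u (n - k) - g k * u (n - k) := by
      intro k _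
      rw [waitingTail_succ, Nat.add_sub_add_right]
      ring
    rw [Finset.sum_congr rfl this, Finset.sum_sub_distrib, ih, ← h.succ n, waitingTail_zero]
    simp

theorem sum_weight_le_one (h : IsRenewal g u) (n : ℕ) (hsum : HasSum g 1) :
    ∑ k ∈ Finset.range n, g k ≤ 1 :=
  sum_le_hasSum _ (fun k _ => h.weight_nonneg k) hsum

theorem waitingTail_nonneg (h : IsRenewal g u) (hsum : HasSum g 1) (k : ℕ) :
    0 ≤ waitingTail g k :=
  sub_nonneg.2 (h.sum_weight_le_one k hsum)

theorem norm_le_one (h : IsRenewal g u) (n : ℕ) : ‖u n‖ ≤ 1 := by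
  rw [Real.norm_of_nonneg (h.nonneg n)]
  exact h.le_one n

/-- Dominated convergence for convolutions along a filter. -/
theorem tendsto_convolution (h : IsRenewal g u) {a w : ℕ → ℝ} {F : Filter ℕ} (hF : F ≤ atTop)
    (ha0 : ∀ k, 0 ≤ a k) (ha : Summable a) (i : ℕ)
    (hw : ∀ k, Tendsto (fun n => u (n - (i + k))) F (𝓝 (w k))) :
    Tendsto (fun n => ∑ k ∈ Finset.range (n - i + 1), a k * u (n - i - k)) F
      (𝓝 (∑' k, a k * w k)) := by
  have heq : (fun n => ∑ k ∈ Finset.range (n - i + 1), a k * u (n - i - k)) =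
      fun n => ∑' k, if k < n - i + 1 then a k * u (n - i - k) else 0 := by
    funext n
    rw [tsum_eq_sum (s := Finset.range (n - i + 1))]
    · exact Finset.sum_congr rfl fun k hk => by rw [if_pos (Finset.mem_range.1 hk)]
    · intro k hk
      rw [if_neg (by simpa using hk)]
  rw [heq]
  refine tendsto_tsum_of_dominated_convergence (bound := a) ha ?_ ?_
  · intro k
    refine Tendsto.congr' ?_ ((hw k).const_mul (a k))
    filter_upwards [hF (eventually_ge_atTop (i + k))] with n hn
    rw [if_pos (by omega), Nat.sub_sub]
  · refine Eventually.of_forall fun n k => ?_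
    split_ifs
    · rw [norm_mul, Real.norm_of_nonneg (ha0 k)]
      exact mul_le_of_le_one_right (ha0 k) (h.norm_le_one _)
    · simpa using ha0 k

/-- Compactness of [0, 1] gives all shifts limits along one ultrafilter; dominated convergence
carries the renewal equation over to them. -/
theorem exists_shift_limit (h : IsRenewal g u) (hg : Summable g) (U : Ultrafilter ℕ)
    (hU : (U : Filter ℕ) ≤ atTop) :
    ∃ w : ℕ → ℝ, (∀ j, Tendsto (fun n => u (n - j)) U (𝓝 (w j))) ∧ (∀ j, |w j| ≤ 1) ∧
      ∀ j, w j = ∑' k, g k * w (j + k + 1) := by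
  have hex : ∀ j, ∃ x ∈ Set.Icc (0 : ℝ) 1, Tendsto (fun n => u (n - j)) U (𝓝 x) := by
    intro j
    exact isCompact_Icc.ultrafilter_le_nhds (U.map fun n => u (n - j))
      (tendsto_principal.2 (Eventually.of_forall fun n => ⟨h.nonneg _, h.le_one _⟩))
  choose w hw hlim using hex
  refine ⟨w, hlim, fun j => abs_le.2 ⟨by linarith [(hw j).1], (hw j).2⟩, fun j => ?_⟩
  refine tendsto_nhds_unique (hlim j) ?_
  have := h.tendsto_convolution (w := fun k => w (j + k + 1)) hU h.weight_nonneg hg (j + 1)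
    (fun k => by
      have := hlim (j + k + 1)
      rwa [show j + k + 1 = j + 1 + k by ring] at this ⊢)
  refine this.congr' ?_
  filter_upwards [hU (eventually_ge_atTop (j + 1))] with n hn
  rw [← h.succ, show n - (j + 1) + 1 = n - j by omega]

/-- An extremal cluster point of the renewal sequence is a limit along an ultrafilter which is
invariant under large shifts. -/
theorem exists_shift_invariant_limit (h : IsRenewal g u) (hg1 : HasSum g 1)
    (hgcd : Nat.setGcd {n | ∃ k, n = k + 1 ∧ 0 < g k} = 1) {a : ℝ} (ha : MapClusterPt a atTop u)
    (hext : (∀ b, MapClusterPt b atTop u → b ≤ a) ∨ ∀ b, MapClusterPt b atTop u → a ≤ b) :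
    ∃ U : Ultrafilter ℕ, (U : Filter ℕ) ≤ atTop ∧
      ∃ J, ∀ j ≥ J, Tendsto (fun n => u (n - j)) U (𝓝 a) := by
  obtain ⟨U, hU, hUa⟩ := mapClusterPt_iff_ultrafilter.1 ha
  obtain ⟨w, hlim, hw1, hw⟩ := h.exists_shift_limit hg1.summable U hU
  have hw0 : w 0 = a := tendsto_nhds_unique (hlim 0) hUa
  have hcl : ∀ j, MapClusterPt (w j) atTop u := fun j =>
    MapClusterPt.of_comp ((tendsto_sub_atTop_nat j).mono_left hU) (hlim j).mapClusterPt
  refine ⟨U, hU, ?_⟩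
  rcases hext with hext | hext
  · obtain ⟨J, hJ⟩ := eventually_const_of_weighted_average h.weight_nonneg hg1 hgcd hw1 hw
      (fun j => hw0 ▸ hext _ (hcl j))
    refine ⟨J, fun j hj => ?_⟩
    rw [← hw0, ← hJ j hj]
    exact hlim j
  -- A minimal cluster point becomes a maximal one after a change of sign.
  · obtain ⟨J, hJ⟩ := eventually_const_of_weighted_average (w := fun j => -w j) (B := 1)
      h.weight_nonneg hg1 hgcd
      (by simpa using hw1) (fun j => by simp only [mul_neg, tsum_neg, ← hw j])
      (fun j => neg_le_neg (hw0 ▸ hext _ (hcl j)))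
    refine ⟨J, fun j hj => ?_⟩
    rw [← hw0, ← neg_injective (hJ j hj)]
    exact hlim j

theorem tsum_waitingTail_mul_eq_one (h : IsRenewal g u) (hg1 : HasSum g 1)
    (hs : Summable (waitingTail g)) {a : ℝ} {U : Filter ℕ} [U.NeBot] (hU : U ≤ atTop) {J : ℕ}
    (hJ : ∀ j ≥ J, Tendsto (fun n => u (n - j)) U (𝓝 a)) :
    (∑' k, waitingTail g k) * a = 1 := by
  have := h.tendsto_convolution (w := fun _ => a) hU (h.waitingTail_nonneg hg1) hs J
    (fun k => hJ _ (by omega))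
  simp only [h.sum_waitingTail_mul, tsum_mul_right] at this
  exact tendsto_nhds_unique this tendsto_const_nhds

/-- Truncating `sum_waitingTail_mul` keeps an inequality in the limit even when the tails are not
summable. -/
theorem sum_waitingTail_mul_le_one (h : IsRenewal g u) (hg1 : HasSum g 1) {a : ℝ} {U : Filter ℕ}
    [U.NeBot] (hU : U ≤ atTop) {J : ℕ} (hJ : ∀ j ≥ J, Tendsto (fun n => u (n - j)) U (𝓝 a))
    (K : ℕ) : (∑ k ∈ Finset.range K, waitingTail g k) * a ≤ 1 := by
  have ht : Tendsto (fun n => ∑ k ∈ Finset.range K, waitingTail g k * u (n - (J + k))) U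
      (𝓝 (∑ k ∈ Finset.range K, waitingTail g k * a)) :=
    tendsto_finsetSum _ fun k _ => (hJ _ (by omega)).const_mul _
  rw [Finset.sum_mul]
  refine le_of_tendsto ht ?_
  filter_upwards [hU (eventually_ge_atTop (J + K))] with n hn
  rw [← h.sum_waitingTail_mul (n - J)]
  simp only [← Nat.sub_sub]
  refine Finset.sum_le_sum_of_subset_of_nonneg (Finset.range_mono (by omega)) fun k _ _ =>
    mul_nonneg (h.waitingTail_nonneg hg1 k) (h.nonneg _)

theorem isBoundedUnder_le (h : IsRenewal g u) : IsBoundedUnder (· ≤ ·) atTop u :=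
  isBoundedUnder_of ⟨1, h.le_one⟩

theorem isBoundedUnder_ge (h : IsRenewal g u) : IsBoundedUnder (· ≥ ·) atTop u :=
  isBoundedUnder_of ⟨0, h.nonneg⟩

/-- The **renewal theorem** of Erdős, Feller and Pollard for finite mean waiting time. -/
theorem tendsto_of_summable (h : IsRenewal g u) (hg1 : HasSum g 1)
    (hgcd : Nat.setGcd {n | ∃ k, n = k + 1 ∧ 0 < g k} = 1) (hs : Summable (waitingTail g)) :
    Tendsto u atTop (𝓝 (∑' k, waitingTail g k)⁻¹) := by
  have hle := h.isBoundedUnder_le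
  have hge := h.isBoundedUnder_ge
  have key : ∀ a, MapClusterPt a atTop u → ((∀ b, MapClusterPt b atTop u → b ≤ a) ∨
      ∀ b, MapClusterPt b atTop u → a ≤ b) → a = (∑' k, waitingTail g k)⁻¹ := by
    intro a ha hext
    obtain ⟨U, hU, J, hJ⟩ := h.exists_shift_invariant_limit hg1 hgcd ha hext
    exact eq_inv_of_mul_eq_one_right (h.tsum_waitingTail_mul_eq_one hg1 hs hU hJ)
  refine tendsto_of_liminf_eq_limsup
    (key _ (MapClusterPt.liminf hle.isCoboundedUnder_ge hge) (Or.inr fun b hb => hb.liminf_le hge))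
    (key _ (MapClusterPt.limsup hge.isCoboundedUnder_le hle) (Or.inl fun b hb => hb.le_limsup hle))
    hle hge

/-- The renewal theorem for infinite mean waiting time. -/
theorem tendsto_zero_of_not_summable (h : IsRenewal g u) (hg1 : HasSum g 1)
    (hgcd : Nat.setGcd {n | ∃ k, n = k + 1 ∧ 0 < g k} = 1) (hs : ¬ Summable (waitingTail g)) :
    Tendsto u atTop (𝓝 0) := by
  have hle := h.isBoundedUnder_le
  have hge := h.isBoundedUnder_ge
  have hcl := MapClusterPt.limsup hge.isCoboundedUnder_le hle
  obtain ⟨U, hU, J, hJ⟩ := h.exists_shift_invariant_limit hg1 hgcd hcl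
    (Or.inl fun b hb => hb.le_limsup hle)
  have hsup : limsup u atTop ≤ 0 := by
    by_contra! hpos
    -- A positive limsup would bound the partial sums of the tails by its inverse.
    refine hs (summable_of_sum_range_le (h.waitingTail_nonneg hg1) (c := (limsup u atTop)⁻¹)
      fun K => ?_)
    rw [← one_div, le_div_iff₀ hpos]
    exact h.sum_waitingTail_mul_le_one hg1 hU hJ K
  exact tendsto_of_le_liminf_of_limsup_le
    (le_liminf_of_le hle.isCoboundedUnder_ge (Eventually.of_forall h.nonneg)) hsup hle hge

/-! ### Summability, period and mean waiting time -/

theorem sum_range_le (h : IsRenewal g u) {F : ℝ} (hF : HasSum g F) (n : ℕ) :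
    ∑ k ∈ Finset.range (n + 1), u k ≤ 1 + F * ∑ k ∈ Finset.range (n + 1), u k := by
  have hF0 : 0 ≤ F := hF.nonneg h.weight_nonneg
  rw [Finset.sum_range_succ', h.zero, add_comm]
  refine add_le_add_right ?_ 1
  have h1 : ∑ m ∈ Finset.range n, u (m + 1) =
      ∑ m ∈ Finset.range n, ∑ k ∈ Finset.range (m + 1), g k * u (m - k) :=
    Finset.sum_congr rfl fun m _ => h.succ m
  have h2 : ∑ m ∈ Finset.range n, ∑ k ∈ Finset.range (m + 1), g k * u (m - k) =
      ∑ k ∈ Finset.range n, ∑ m ∈ Finset.range (n - k), g k * u m := by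
    exact Finset.sum_range_diag_flip n fun k m => g k * u m
  have h3 : ∀ k, ∑ m ∈ Finset.range (n - k), u m ≤ ∑ m ∈ Finset.range n, u (m + 1) + 1 := by
    intro k
    rw [← h.zero, ← Finset.sum_range_succ']
    exact Finset.sum_le_sum_of_subset_of_nonneg (Finset.range_mono (by omega))
      fun i _ _ => h.nonneg i
  have hn : (0 : ℝ) ≤ ∑ m ∈ Finset.range n, u (m + 1) + 1 :=
    add_nonneg (Finset.sum_nonneg fun i _ => h.nonneg _) zero_le_one
  rw [add_comm (1 : ℝ)]
  calc ∑ m ∈ Finset.range n, u (m + 1)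
      = ∑ k ∈ Finset.range n, ∑ m ∈ Finset.range (n - k), g k * u m := h1.trans h2
    _ ≤ ∑ k ∈ Finset.range n, g k * (∑ m ∈ Finset.range n, u (m + 1) + 1) := by
        refine Finset.sum_le_sum fun k _ => ?_
        rw [← Finset.mul_sum]
        exact mul_le_mul_of_nonneg_left (h3 k) (h.weight_nonneg k)
    _ ≤ F * (∑ m ∈ Finset.range n, u (m + 1) + 1) := by
        rw [← Finset.sum_mul]
        exact mul_le_mul_of_nonneg_right
          (sum_le_hasSum _ (fun k _ => h.weight_nonneg k) hF) hn

theorem summable_of_lt_one (h : IsRenewal g u) {F : ℝ} (hF : HasSum g F) (hF1 : F < 1) :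
    Summable u := by
  refine summable_of_sum_range_le h.nonneg (c := (1 - F)⁻¹) fun n => ?_
  refine (Finset.sum_le_sum_of_subset_of_nonneg (Finset.range_mono n.le_succ)
      fun i _ _ => h.nonneg i).trans ?_
  rw [← one_div, le_div_iff₀ (by linarith)]
  linarith [h.sum_range_le hF n]

/-- If `u` were summable, the Cauchy product would give `∑ u (n + 1) = 1 * ∑ u n`, contradicting `u
0 = 1`. -/
theorem not_summable_of_hasSum_one (h : IsRenewal g u) (hF : HasSum g 1) : ¬ Summable u := by
  intro hu
  have hug : Summable fun k => ‖g k‖ := hF.summable.norm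
  have huu : Summable fun k => ‖u k‖ := hu.norm
  have h1 := tsum_mul_tsum_eq_tsum_sum_range_of_summable_norm hug huu
  rw [hF.tsum_eq, one_mul, tsum_congr fun n => (h.succ n).symm] at h1
  have h2 := hu.tsum_eq_zero_add
  rw [h.zero] at h2
  linarith

theorem dvd_of_pos (h : IsRenewal g u) {d : ℕ} (hd : ∀ k, 0 < g k → d ∣ k + 1) (n : ℕ)
    (hn : 0 < u n) : d ∣ n := by
  induction n using Nat.strong_induction_on with
  | _ n ih =>
    rcases n with _ | n
    · exact dvd_zero d
    · rw [h.succ] at hn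
      obtain ⟨k, hk, hpos⟩ := Finset.exists_lt_of_sum_lt (f := fun _ => (0 : ℝ))
        (by simpa using hn)
      have hk' : k < n + 1 := Finset.mem_range.1 hk
      have hg := (pos_iff_pos_of_mul_pos hpos)
      have hgk : 0 < g k := (h.weight_nonneg k).lt_of_ne fun h0 => by simp [← h0] at hpos
      have := dvd_add (hd k hgk) (ih (n - k) (by omega) (hg.1 hgk))
      rwa [show k + 1 + (n - k) = n + 1 by omega] at this

/-- Every possible renewal time is a sum of possible waiting times, so a common divisor of the
latter divides the former. -/
theorem setGcd_eq_one (h : IsRenewal g u) (hu : Nat.setGcd {n | 1 ≤ n ∧ 0 < u n} = 1) :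
    Nat.setGcd {n | ∃ k, n = k + 1 ∧ 0 < g k} = 1 := by
  refine Nat.dvd_one.1 ((Nat.dvd_setGcd_iff.2 fun n hn => ?_).trans hu.dvd)
  refine h.dvd_of_pos (fun k hk => Nat.setGcd_dvd_of_mem ?_) n hn.2
  exact ⟨k, rfl, hk⟩

/-- The mean is the sum of the tail probabilities, by Tonelli. -/
theorem tsum_mul_ofReal (h : IsRenewal g u) (hg1 : HasSum g 1) :
    ∑' k : ℕ, ((k + 1 : ℕ) : ℝ≥0∞) * ENNReal.ofReal (g k) =
      ∑' l, ENNReal.ofReal (waitingTail g l) := by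
  have h1 : ∀ k : ℕ, ((k + 1 : ℕ) : ℝ≥0∞) * ENNReal.ofReal (g k) =
      ∑' l : ℕ, if l < k + 1 then ENNReal.ofReal (g k) else 0 := by
    intro k
    rw [tsum_eq_sum (s := Finset.range (k + 1)) fun l hl => if_neg (by simpa using hl),
      Finset.sum_congr rfl fun l hl => if_pos (Finset.mem_range.1 hl)]
    simp
  rw [tsum_congr h1, ENNReal.tsum_comm]
  refine tsum_congr fun l => ?_
  have h2 : ∑ k ∈ Finset.range l, ENNReal.ofReal (g k) =
      ∑' k : ℕ, if k < l then ENNReal.ofReal (g k) else 0 := by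
    rw [tsum_eq_sum (s := Finset.range l) fun k hk => if_neg (by simpa using hk)]
    exact Finset.sum_congr rfl fun k hk => (if_pos (Finset.mem_range.1 hk)).symm
  have h3 : ∑ k ∈ Finset.range l, ENNReal.ofReal (g k) ≠ ∞ := by
    simp [ENNReal.sum_eq_top]
  -- Adding the finite mass below `l` avoids subtraction in `ℝ≥0∞`.
  refine (ENNReal.add_left_inj h3).1 ?_
  rw [← ENNReal.ofReal_sum_of_nonneg fun k _ => h.weight_nonneg k,
    ← ENNReal.ofReal_add (h.waitingTail_nonneg hg1 l) (Finset.sum_nonneg fun k _ =>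
      h.weight_nonneg k), ENNReal.ofReal_sum_of_nonneg fun k _ => h.weight_nonneg k, h2,
    ← ENNReal.tsum_add]
  simp only [waitingTail, sub_add_cancel]
  rw [← hg1.tsum_eq, ENNReal.ofReal_tsum_of_nonneg h.weight_nonneg hg1.summable]
  refine tsum_congr fun k => ?_
  by_cases hk : k < l
  · simp [hk, show ¬ l < k + 1 by omega]
  · simp [hk, show l < k + 1 by omega]

theorem summable_waitingTail_iff (h : IsRenewal g u) (hg1 : HasSum g 1) :
    Summable (waitingTail g) ↔
      ∑' k : ℕ, ((k + 1 : ℕ) : ℝ≥0∞) * ENNReal.ofReal (g k) < ∞ := by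
  rw [h.tsum_mul_ofReal hg1]
  constructor
  · intro hs
    rw [← ENNReal.ofReal_tsum_of_nonneg (h.waitingTail_nonneg hg1) hs]
    exact ENNReal.ofReal_lt_top
  · intro hs
    refine (ENNReal.summable_toReal hs.ne).congr fun l => ?_
    exact ENNReal.toReal_ofReal (h.waitingTail_nonneg hg1 l)

end IsRenewal

/-! ### Markov chains: transition and first passage probabilities -/

variable {ι : Type*}

/-- Row-stochastic matrices over an arbitrary index type. -/
structure IsStochastic (P : Matrix ι ι ℝ) : Prop where
  nonneg : ∀ i j, 0 ≤ P i j
  hasSum_row : ∀ i, HasSum (fun j => P i j) 1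

open Classical in
/-- The `n`-step transition probabilities of the Markov chain with transition matrix `P`. -/
noncomputable def nStep (P : Matrix ι ι ℝ) : ℕ → ι → ι → ℝ
  | 0, i, j => if i = j then 1 else 0
  | n + 1, i, j => ∑' k, P i k * nStep P n k j

theorem nStep_succ (P : Matrix ι ι ℝ) (n : ℕ) (i j : ι) :
    nStep P (n + 1) i j = ∑' k, P i k * nStep P n k j := rfl

theorem nStep_zero_self (P : Matrix ι ι ℝ) (i : ι) : nStep P 0 i i = 1 := by
  simp [nStep]

theorem nStep_one (P : Matrix ι ι ℝ) (i j : ι) : nStep P 1 i j = P i j := by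
  classical
  rw [nStep_succ, tsum_eq_single j]
  · simp [nStep]
  · intro k hk
    simp [nStep, hk]

theorem firstPassage_one (P : Matrix ι ι ℝ) (i j : ι) : firstPassage P j 1 i = P i j := rfl

theorem firstPassage_succ_succ (P : Matrix ι ι ℝ) (n : ℕ) (i j : ι) :
    firstPassage P j (n + 2) i =
      ∑' k : {k : ι // k ≠ j}, P i k.1 * firstPassage P j (n + 1) k.1 := rfl

namespace IsStochastic

variable {P : Matrix ι ι ℝ}

theorem summable_mul (hP : IsStochastic P) (i : ι) {g : ι → ℝ} {B : ℝ} (hg : ∀ k, |g k| ≤ B) :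
    Summable fun k => P i k * g k := by
  refine Summable.of_norm_bounded ((hP.hasSum_row i).summable.mul_right B) fun k => ?_
  rw [norm_mul, Real.norm_of_nonneg (hP.nonneg i k)]
  exact mul_le_mul_of_nonneg_left (hg k) (hP.nonneg i k)

theorem tsum_mul_le_one (hP : IsStochastic P) (i : ι) {g : ι → ℝ} (h0 : ∀ k, 0 ≤ g k)
    (h1 : ∀ k, g k ≤ 1) : ∑' k, P i k * g k ≤ 1 := by
  rw [← (hP.hasSum_row i).tsum_eq]
  refine (hP.summable_mul i (B := 1) fun k => ?_).tsum_le_tsum (fun k => ?_)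
    (hP.hasSum_row i).summable
  · rw [abs_of_nonneg (h0 k)]
    exact h1 k
  · exact mul_le_of_le_one_right (hP.nonneg i k) (h1 k)

theorem nStep_nonneg (hP : IsStochastic P) (n : ℕ) (i j : ι) : 0 ≤ nStep P n i j := by
  induction n generalizing i with
  | zero => rw [nStep]; split_ifs <;> norm_num
  | succ n ih => exact tsum_nonneg fun k => mul_nonneg (hP.nonneg i k) (ih k)

theorem sum_nStep_le_one (hP : IsStochastic P) (n : ℕ) (i : ι) (S : Finset ι) :
    ∑ j ∈ S, nStep P n i j ≤ 1 := by
  classical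
  induction n generalizing i S with
  | zero => simp only [nStep, Finset.sum_ite_eq]; split_ifs <;> norm_num
  | succ n ih =>
    have hle : ∀ k j, |nStep P n k j| ≤ 1 := fun k j => by
      rw [abs_of_nonneg (hP.nStep_nonneg n k j)]
      simpa using ih k {j}
    simp only [nStep_succ]
    rw [← Summable.tsum_finsetSum fun j _ => hP.summable_mul i fun k => hle k j]
    simp only [← Finset.mul_sum]
    exact hP.tsum_mul_le_one i (fun k => Finset.sum_nonneg fun j _ => hP.nStep_nonneg n k j)
      fun k => ih k S

theorem nStep_le_one (hP : IsStochastic P) (n : ℕ) (i j : ι) : nStep P n i j ≤ 1 := by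
  simpa using hP.sum_nStep_le_one n i {j}

theorem abs_nStep_le_one (hP : IsStochastic P) (n : ℕ) (i j : ι) : |nStep P n i j| ≤ 1 := by
  rw [abs_of_nonneg (hP.nStep_nonneg n i j)]
  exact hP.nStep_le_one n i j

/-- This half of Chapman–Kolmogorov, over finitely many intermediate states, is all that is needed
for general `m` and `n`. -/
theorem sum_nStep_mul_le (hP : IsStochastic P) (m n : ℕ) (i j : ι) (S : Finset ι) :
    ∑ k ∈ S, nStep P m i k * nStep P n k j ≤ nStep P (m + n) i j := by
  classical
  induction m generalizing i with
  | zero =>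
    simp only [nStep, ite_mul, one_mul, zero_mul, Finset.sum_ite_eq, zero_add]
    split_ifs
    · exact le_rfl
    · exact hP.nStep_nonneg n i j
  | succ m ih =>
    rw [Nat.add_right_comm]
    simp only [nStep_succ, ← tsum_mul_right]
    have hs : ∀ k ∈ S, Summable fun l => P i l * nStep P m l k * nStep P n k j := fun k _ =>
      (hP.summable_mul i fun l => hP.abs_nStep_le_one m l k).mul_right _
    rw [← Summable.tsum_finsetSum hs]
    refine (summable_sum hs).tsum_le_tsum (fun l => ?_)
      (hP.summable_mul i fun l => hP.abs_nStep_le_one (m + n) l j)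
    simp only [mul_assoc, ← Finset.mul_sum]
    exact mul_le_mul_of_nonneg_left (ih l) (hP.nonneg i l)

theorem nStep_mul_le (hP : IsStochastic P) (m n : ℕ) (i k j : ι) :
    nStep P m i k * nStep P n k j ≤ nStep P (m + n) i j := by
  simpa using hP.sum_nStep_mul_le m n i j {k}

theorem tsum_eq_add_tsum_ne (hP : IsStochastic P) (i j : ι) {g : ι → ℝ} {B : ℝ}
    (hg : ∀ k, |g k| ≤ B) :
    ∑' k, P i k * g k = P i j * g j + ∑' k : {k : ι // k ≠ j}, P i k.1 * g k.1 := by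
  have := (hP.summable_mul i hg).tsum_subtype_add_tsum_subtype_compl {j}
  rw [← this, tsum_singleton j fun k => P i k * g k]
  rfl

theorem firstPassage_nonneg (hP : IsStochastic P) (n : ℕ) (i j : ι) :
    0 ≤ firstPassage P j n i := by
  induction n generalizing i with
  | zero => exact le_rfl
  | succ n ih =>
    rcases n with _ | n
    · exact hP.nonneg i j
    · exact tsum_nonneg fun k => mul_nonneg (hP.nonneg i k) (ih k)

theorem summable_mul_subtype (hP : IsStochastic P) (i j : ι) {g : ι → ℝ} {B : ℝ}
    (hg : ∀ k, |g k| ≤ B) : Summable fun k : {k : ι // k ≠ j} => P i k.1 * g k.1 :=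
  (hP.summable_mul i hg).subtype {k | k ≠ j}

/-- Condition on the first step: it hits `j`, or it reaches a state to which the shorter horizon
applies. -/
theorem sum_firstPassage_le_one (hP : IsStochastic P) (n : ℕ) (i j : ι) :
    ∑ k ∈ Finset.range n, firstPassage P j (k + 1) i ≤ 1 := by
  induction n generalizing i with
  | zero => simp
  | succ n ih =>
    have hle : ∀ k ∈ Finset.range n, ∀ l, |firstPassage P j (k + 1) l| ≤ 1 := by
      intro k hk l
      rw [abs_of_nonneg (hP.firstPassage_nonneg _ l j)]
      exact (Finset.single_le_sum (f := fun k => firstPassage P j (k + 1) l)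
        (fun k _ => hP.firstPassage_nonneg _ l j) hk).trans (ih l)
    rw [Finset.sum_range_succ']
    simp only [firstPassage_succ_succ, firstPassage_one, zero_add]
    rw [← Summable.tsum_finsetSum fun k hk => hP.summable_mul_subtype i j (hle k hk)]
    simp only [← Finset.mul_sum]
    have h1 := hP.tsum_eq_add_tsum_ne i j (g := fun _ => 1) (B := 1) (by simp)
    simp only [mul_one, (hP.hasSum_row i).tsum_eq] at h1
    rw [h1, add_comm]
    have hrow : Summable fun l : {l : ι // l ≠ j} => P i l.1 :=
      (hP.hasSum_row i).summable.subtype {k | k ≠ j}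
    refine add_le_add_right ?_ _
    refine (hP.summable_mul_subtype i j (B := 1)
      (g := fun l => ∑ k ∈ Finset.range n, firstPassage P j (k + 1) l) fun l => ?_).tsum_le_tsum
      (fun l => ?_) hrow
    · rw [abs_of_nonneg (Finset.sum_nonneg fun k _ => hP.firstPassage_nonneg _ l j)]
      exact ih l
    · exact mul_le_of_le_one_right (hP.nonneg i l) (ih l)

theorem firstPassage_succ_le_one (hP : IsStochastic P) (n : ℕ) (i j : ι) :
    firstPassage P j (n + 1) i ≤ 1 :=
  (Finset.single_le_sum (f := fun k => firstPassage P j (k + 1) i)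
    (fun _ _ => hP.firstPassage_nonneg _ i j) (Finset.self_mem_range_succ n)).trans
    (hP.sum_firstPassage_le_one (n + 1) i j)

theorem summable_firstPassage (hP : IsStochastic P) (i j : ι) :
    Summable fun k => firstPassage P j (k + 1) i :=
  summable_of_sum_range_le (fun _ => hP.firstPassage_nonneg _ i j)
    fun n => hP.sum_firstPassage_le_one n i j

/-- The first passage decomposition. -/
theorem nStep_succ_eq_sum (hP : IsStochastic P) (n : ℕ) (i j : ι) :
    nStep P (n + 1) i j =
      ∑ k ∈ Finset.range (n + 1), firstPassage P j (k + 1) i * nStep P (n - k) j j := by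
  induction n generalizing i with
  | zero => simp [nStep_one, nStep_zero_self, firstPassage_one]
  | succ n ih =>
    rw [nStep_succ, hP.tsum_eq_add_tsum_ne i j fun k => hP.abs_nStep_le_one _ k j,
      Finset.sum_range_succ', add_comm]
    congr 1
    have hs : ∀ k ∈ Finset.range (n + 1), Summable fun l : {l : ι // l ≠ j} =>
        P i l.1 * firstPassage P j (k + 1) l.1 * nStep P (n - k) j j := fun k _ =>
      (hP.summable_mul_subtype i j (B := 1) fun l => by
        rw [abs_of_nonneg (hP.firstPassage_nonneg _ l j)]
        exact hP.firstPassage_succ_le_one k l j).mul_right _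
    simp only [firstPassage_succ_succ, ← tsum_mul_right, Nat.add_sub_add_right]
    rw [← Summable.tsum_finsetSum hs]
    refine tsum_congr fun l => ?_
    rw [ih, Finset.mul_sum]
    simp only [mul_assoc]

theorem isRenewal (hP : IsStochastic P) (j : ι) :
    IsRenewal (fun k => firstPassage P j (k + 1) j) fun n => nStep P n j j where
  weight_nonneg _ := hP.firstPassage_nonneg _ j j
  nonneg n := hP.nStep_nonneg n j j
  le_one n := hP.nStep_le_one n j j
  zero := nStep_zero_self P j
  succ n := hP.nStep_succ_eq_sum n j j

theorem returnProb_eq (hP : IsStochastic P) (j : ι) :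
    returnProb P j = ENNReal.ofReal (∑' k, firstPassage P j (k + 1) j) := by
  rw [returnProb, tsum_eq_zero_add' ENNReal.summable, ENNReal.ofReal_tsum_of_nonneg
    (fun k => hP.firstPassage_nonneg _ j j) (hP.summable_firstPassage j j)]
  simp [firstPassage]

theorem meanReturnTime_eq (P : Matrix ι ι ℝ) (j : ι) :
    meanReturnTime P j =
      ∑' k : ℕ, ((k + 1 : ℕ) : ℝ≥0∞) * ENNReal.ofReal (firstPassage P j (k + 1) j) := by
  rw [meanReturnTime, tsum_eq_zero_add' ENNReal.summable]
  simp

theorem returnProb_lt_one_or_eq_one (hP : IsStochastic P) (j : ι) :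
    returnProb P j < 1 ∨ returnProb P j = 1 := by
  refine lt_or_eq_of_le ?_
  rw [hP.returnProb_eq, ENNReal.ofReal_le_one]
  exact Real.tsum_le_of_sum_range_le (fun k => hP.firstPassage_nonneg _ j j)
    fun n => hP.sum_firstPassage_le_one n j j

theorem hasSum_firstPassage_of_returnProb (hP : IsStochastic P) {j : ι}
    (h : returnProb P j = 1) : HasSum (fun k => firstPassage P j (k + 1) j) 1 := by
  rw [hP.returnProb_eq, ENNReal.ofReal_eq_one] at h
  rw [← h]
  exact (hP.summable_firstPassage j j).hasSum

/-- Transience means a finite expected number of visits; this form can be compared between states.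
-/
theorem returnProb_lt_one_iff (hP : IsStochastic P) (j : ι) :
    returnProb P j < 1 ↔ Summable fun n => nStep P n j j := by
  constructor
  · intro h
    rw [hP.returnProb_eq, ENNReal.ofReal_lt_one] at h
    exact (hP.isRenewal j).summable_of_lt_one (hP.summable_firstPassage j j).hasSum h
  · intro h
    refine (hP.returnProb_lt_one_or_eq_one j).resolve_right fun h1 => ?_
    exact (hP.isRenewal j).not_summable_of_hasSum_one (hP.hasSum_firstPassage_of_returnProb h1) h

/-- Convergence of the return probabilities of an aperiodic state. -/
theorem exists_tendsto_nStep_self (hP : IsStochastic P) (j : ι)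
    (hj : Nat.setGcd {n | 1 ≤ n ∧ 0 < nStep P n j j} = 1) :
    ∃ L : ℝ, Tendsto (fun n => nStep P n j j) atTop (𝓝 L) ∧
      (0 < L ↔ returnProb P j = 1 ∧ meanReturnTime P j < ∞) := by
  have hR := hP.isRenewal j
  have hgcd := hR.setGcd_eq_one hj
  rcases hP.returnProb_lt_one_or_eq_one j with h | h
  · exact ⟨0, ((hP.returnProb_lt_one_iff j).1 h).tendsto_atTop_zero, by simp [h.ne]⟩
  · have h1 := hP.hasSum_firstPassage_of_returnProb h
    have hm := hR.summable_waitingTail_iff h1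
    rw [← meanReturnTime_eq] at hm
    by_cases hs : Summable (waitingTail fun k => firstPassage P j (k + 1) j)
    · refine ⟨_, hR.tendsto_of_summable h1 hgcd hs, ?_⟩
      simp only [h, hm.1 hs, and_self, iff_true, inv_pos]
      refine hs.tsum_pos (hR.waitingTail_nonneg h1) 0 ?_
      rw [waitingTail_zero]
      exact one_pos
    · refine ⟨0, hR.tendsto_zero_of_not_summable h1 hgcd hs, ?_⟩
      simp [← hm, hs]

theorem tendsto_nStep (hP : IsStochastic P) {j : ι} {L : ℝ}
    (hL : Tendsto (fun n => nStep P n j j) atTop (𝓝 L)) (i : ι) :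
    Tendsto (fun n => nStep P n i j) atTop
      (𝓝 ((∑' k, firstPassage P j (k + 1) i) * L)) := by
  rw [← tendsto_add_atTop_iff_nat 1]
  simp only [hP.nStep_succ_eq_sum _ i j, ← tsum_mul_right]
  exact (hP.isRenewal j).tendsto_convolution (w := fun _ => L) le_rfl
    (fun k => hP.firstPassage_nonneg _ i j) (hP.summable_firstPassage i j) 0
    fun k => hL.comp (tendsto_sub_atTop_nat (0 + k))

/-- Maximum principle: a harmonic function that is maximal at `i` is maximal at every state
reachable from `i`. -/
theorem eq_of_nStep_pos (hP : IsStochastic P) {w : ι → ℝ} {B M : ℝ} (hB : ∀ k, |w k| ≤ B)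
    (hw : ∀ i, w i = ∑' k, P i k * w k) (hM : ∀ k, w k ≤ M) (n : ℕ) (i j : ι) (hi : w i = M)
    (hij : 0 < nStep P n i j) : w j = M := by
  induction n generalizing i with
  | zero =>
    rw [nStep] at hij
    split_ifs at hij with h
    · rwa [← h]
    · exact absurd hij (lt_irrefl _)
  | succ n ih =>
    obtain ⟨k, hk⟩ : ∃ k, P i k * nStep P n k j ≠ 0 := by
      by_contra! hall
      rw [nStep_succ, tsum_congr hall, tsum_zero] at hij
      exact lt_irrefl _ hij
    have h0 : HasSum (fun k => P i k * (M - w k)) 0 := by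
      have := ((hP.hasSum_row i).mul_right M).sub (hP.summable_mul i hB).hasSum
      rw [← hw i, hi, one_mul, sub_self] at this
      simpa [mul_sub] using this
    have h1 := congrFun ((hasSum_zero_iff_of_nonneg
      (fun k => mul_nonneg (hP.nonneg i k) (sub_nonneg.2 (hM _)))).1 h0) k
    simp only [Pi.zero_apply, mul_eq_zero, left_ne_zero_of_mul hk, false_or] at h1
    exact ih k (by linarith) ((hP.nStep_nonneg n k j).lt_of_ne' (right_ne_zero_of_mul hk))

/-- In an irreducible chain, the limit of the transition probabilities does not depend on the
initial state. -/
theorem tendsto_nStep_of_irreducible (hP : IsStochastic P) (hirr : ∀ i j, ∃ n, 0 < nStep P n i j)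
    {j : ι} {L : ℝ} (hL : Tendsto (fun n => nStep P n j j) atTop (𝓝 L)) (i : ι) :
    Tendsto (fun n => nStep P n i j) atTop (𝓝 L) := by
  set w : ι → ℝ := fun i => (∑' k, firstPassage P j (k + 1) i) * L with hwdef
  have hlim : ∀ i, Tendsto (fun n => nStep P n i j) atTop (𝓝 (w i)) := hP.tendsto_nStep hL
  have hL0 : 0 ≤ L := ge_of_tendsto' hL fun n => hP.nStep_nonneg n j j
  have hB : ∀ k, |w k| ≤ 1 := fun k => abs_le.2
    ⟨by linarith [ge_of_tendsto' (hlim k) fun n => hP.nStep_nonneg n k j],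
      le_of_tendsto' (hlim k) fun n => hP.nStep_le_one n k j⟩
  have hharm : ∀ i, w i = ∑' k, P i k * w k := by
    intro i
    refine tendsto_nhds_unique ((tendsto_add_atTop_iff_nat 1).2 (hlim i)) ?_
    refine tendsto_tsum_of_dominated_convergence (bound := fun k => P i k)
      (hP.hasSum_row i).summable (fun k => (hlim k).const_mul _)
      (Eventually.of_forall fun n k => ?_)
    rw [norm_mul, Real.norm_of_nonneg (hP.nonneg i k)]
    exact mul_le_of_le_one_right (hP.nonneg i k) (hP.abs_nStep_le_one n k j)
  have hM : ∀ k, w k ≤ L := fun k => mul_le_of_le_one_left hL0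
    (Real.tsum_le_of_sum_range_le (fun n => hP.firstPassage_nonneg _ k j)
      fun n => hP.sum_firstPassage_le_one n k j)
  obtain ⟨n, hn⟩ := hirr j i
  rw [← hP.eq_of_nStep_pos hB hharm hM n j i (tendsto_nhds_unique (hlim j) hL) hn]
  exact hlim i

/-- Go from `j` to `i`, loop at `i`, and go back to `j`. This makes recurrence types agree across
states. -/
theorem exists_mul_nStep_le (hP : IsStochastic P) (hirr : ∀ i j, ∃ n, 0 < nStep P n i j)
    (i j : ι) : ∃ c : ℝ, 0 < c ∧ ∃ d, ∀ n, c * nStep P n i i ≤ nStep P (n + d) j j := by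
  obtain ⟨a, ha⟩ := hirr j i
  obtain ⟨b, hb⟩ := hirr i j
  refine ⟨nStep P a j i * nStep P b i j, mul_pos ha hb, a + b, fun n => ?_⟩
  have h1 := hP.nStep_mul_le a n j i i
  have h2 := hP.nStep_mul_le (a + n) b j i j
  rw [show n + (a + b) = a + n + b by ring]
  nlinarith [mul_le_mul_of_nonneg_right h1 hb.le]

/-! ### Stationary vectors and the convergence theorem -/

theorem tsum_mul_tsum_comm (hP : IsStochastic P) {ν g : ι → ℝ} {B : ℝ} (hν : ∀ i, 0 ≤ ν i)
    (hs : Summable ν) (hg : ∀ k, |g k| ≤ B) :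
    ∑' i, ν i * ∑' k, P i k * g k = ∑' k, (∑' i, ν i * P i k) * g k := by
  have h1 : Summable fun x : ι × ι => ν x.1 * P x.1 x.2 := by
    have hn : 0 ≤ fun x : ι × ι => ν x.1 * P x.1 x.2 := fun x =>
      mul_nonneg (hν x.1) (hP.nonneg x.1 x.2)
    refine (summable_prod_of_nonneg hn).2 ?_
    refine ⟨fun i => (hP.hasSum_row i).summable.mul_left (ν i), ?_⟩
    have hrow : ∀ i, ∑' k, ν i * P i k = ν i := fun i => by
      rw [tsum_mul_left, (hP.hasSum_row i).tsum_eq, mul_one]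
    exact hs.congr fun i => (hrow i).symm
  have h2 : Summable fun x : ι × ι => ν x.1 * P x.1 x.2 * g x.2 := by
    refine Summable.of_norm_bounded (h1.mul_right B) fun x => ?_
    rw [norm_mul, Real.norm_of_nonneg (mul_nonneg (hν x.1) (hP.nonneg x.1 x.2))]
    exact mul_le_mul_of_nonneg_left (hg _) (mul_nonneg (hν x.1) (hP.nonneg x.1 x.2))
  calc ∑' i, ν i * ∑' k, P i k * g k = ∑' i, ∑' k, ν i * P i k * g k :=
        tsum_congr fun i => by simp only [← tsum_mul_left, mul_assoc]
    _ = ∑' k, ∑' i, ν i * P i k * g k :=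
        (Summable.tsum_comm (f := fun i k => ν i * P i k * g k) h2).symm
    _ = _ := tsum_congr fun k => tsum_mul_right

theorem abs_le_one (hP : IsStochastic P) (i j : ι) : |P i j| ≤ 1 := by
  rw [← nStep_one P]
  exact hP.abs_nStep_le_one 1 i j

theorem summable_weight_mul {ν g : ι → ℝ} (hν : ∀ i, 0 ≤ ν i) (hs : Summable ν)
    (hg : ∀ k, |g k| ≤ 1) : Summable fun i => ν i * g i := by
  refine Summable.of_norm_bounded hs fun i => ?_
  rw [norm_mul, Real.norm_of_nonneg (hν i)]
  exact mul_le_of_le_one_right (hν i) (hg i)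

theorem tsum_mul_nStep_of_stationary (hP : IsStochastic P) {ν : ι → ℝ} (hν : ∀ i, 0 ≤ ν i)
    (hs : Summable ν) (hst : ∀ j, ∑' i, ν i * P i j = ν j) (n : ℕ) (j : ι) :
    ∑' i, ν i * nStep P n i j = ν j := by
  classical
  induction n with
  | zero => simp [nStep, tsum_ite_eq]
  | succ n ih =>
    simp only [nStep_succ]
    rw [hP.tsum_mul_tsum_comm hν hs fun k => hP.abs_nStep_le_one n k j]
    simpa only [hst] using ih

/-- Let `n → ∞` in `ν = ν Pⁿ`. Applied to `ν` this gives uniqueness; applied to `μ` itself it gives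
total mass 1. -/
theorem stationary_eq_mul_limit (hP : IsStochastic P) {ν μ : ι → ℝ} (hν : ∀ i, 0 ≤ ν i)
    (hs : Summable ν) (hst : ∀ j, ∑' i, ν i * P i j = ν j)
    (hμ : ∀ i j, Tendsto (fun n => nStep P n i j) atTop (𝓝 (μ j))) (j : ι) :
    ν j = (∑' i, ν i) * μ j := by
  rw [← tsum_mul_right]
  refine tendsto_nhds_unique (f := fun n => ∑' i, ν i * nStep P n i j) (l := atTop) ?_ ?_
  · simp only [hP.tsum_mul_nStep_of_stationary hν hs hst]
    exact tendsto_const_nhds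
  · refine tendsto_tsum_of_dominated_convergence hs (fun i => (hμ i j).const_mul _)
      (Eventually.of_forall fun n i => ?_)
    rw [norm_mul, Real.norm_of_nonneg (hν i)]
    exact mul_le_of_le_one_right (hν i) (hP.abs_nStep_le_one n i j)

theorem summable_limit [Nonempty ι] (hP : IsStochastic P) {μ : ι → ℝ}
    (hμ : ∀ i j, Tendsto (fun n => nStep P n i j) atTop (𝓝 (μ j))) : Summable μ := by
  obtain ⟨i⟩ := ‹Nonempty ι›
  refine summable_of_sum_le (fun j => ge_of_tendsto' (hμ i j) fun n => hP.nStep_nonneg n i j)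
    (c := 1) fun S => ?_
  exact le_of_tendsto' (tendsto_finsetSum S fun j _ => hμ i j) fun n =>
    hP.sum_nStep_le_one n i S

theorem limit_stationary [Nonempty ι] (hP : IsStochastic P) {μ : ι → ℝ}
    (hμ : ∀ i j, Tendsto (fun n => nStep P n i j) atTop (𝓝 (μ j))) (j : ι) :
    ∑' i, μ i * P i j = μ j := by
  have hs := hP.summable_limit hμ
  obtain ⟨i₀⟩ := ‹Nonempty ι›
  have h0 : ∀ j, 0 ≤ μ j := fun j => ge_of_tendsto' (hμ i₀ j) fun n => hP.nStep_nonneg n i₀ j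
  -- Fatou gives only `μ P ≤ μ`; equality follows because both sides have the same finite total
  -- mass.
  have hle : ∀ j, ∑' i, μ i * P i j ≤ μ j := by
    intro j
    refine Real.tsum_le_of_sum_le (fun i => mul_nonneg (h0 i) (hP.nonneg i j)) fun S => ?_
    refine le_of_tendsto_of_tendsto' (tendsto_finsetSum S fun i _ =>
      (hμ i₀ i).mul_const (P i j)) ((tendsto_add_atTop_iff_nat 1).2 (hμ i₀ j)) fun n => ?_
    simpa only [nStep_one] using hP.sum_nStep_mul_le n 1 i₀ j S
  have hsP : Summable fun j => ∑' i, μ i * P i j :=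
    hs.of_nonneg_of_le (fun j => tsum_nonneg fun i => mul_nonneg (h0 i) (hP.nonneg i j)) hle
  have htot := hP.tsum_mul_tsum_comm (g := fun _ => 1) (B := 1) h0 hs (by simp)
  simp only [mul_one, (hP.hasSum_row _).tsum_eq] at htot
  have hz : HasSum (fun j => μ j - ∑' i, μ i * P i j) 0 := by
    have := hs.hasSum.sub hsP.hasSum
    rwa [← htot, sub_self] at this
  have := congrFun ((hasSum_zero_iff_of_nonneg fun j => sub_nonneg.2 (hle j)).1 hz) j
  simp only [Pi.zero_apply] at this
  linarith

/-- The convergence theorem for irreducible aperiodic Markov chains. -/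
theorem convergence [Nonempty ι] (hP : IsStochastic P) (hirr : ∀ i j, ∃ n, 0 < nStep P n i j)
    (haper : ∀ j, Nat.setGcd {n | 1 ≤ n ∧ 0 < nStep P n j j} = 1) :
    ∃ μ : ι → ℝ, (∀ i j, Tendsto (fun n => nStep P n i j) atTop (𝓝 (μ j))) ∧
      ((IsTransient P ∨ IsNullRecurrent P) ∨ IsPositiveRecurrent P) ∧
      ((IsTransient P ∨ IsNullRecurrent P) → ∀ j, μ j = 0) ∧
      (IsPositiveRecurrent P → (∀ j, 0 < μ j) ∧ HasSum μ 1 ∧ IsStationaryProbVector P μ ∧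
        ∀ ν, IsStationaryProbVector P ν → ν = μ) := by
  choose μ hself hpos using fun j => hP.exists_tendsto_nStep_self j (haper j)
  have hμ : ∀ i j, Tendsto (fun n => nStep P n i j) atTop (𝓝 (μ j)) := fun i j =>
    hP.tendsto_nStep_of_irreducible hirr (hself j) i
  have h0 : ∀ j, 0 ≤ μ j := fun j => ge_of_tendsto' (hself j) fun n => hP.nStep_nonneg n j j
  have htrans : ∀ i j, returnProb P j < 1 → returnProb P i < 1 := by
    intro i j hj
    obtain ⟨c, hc, d, hcd⟩ := hP.exists_mul_nStep_le hirr i j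
    rw [hP.returnProb_lt_one_iff] at hj ⊢
    rw [← summable_mul_left_iff hc.ne']
    exact ((summable_nat_add_iff d).2 hj).of_nonneg_of_le
      (fun n => mul_nonneg hc.le (hP.nStep_nonneg n i i)) hcd
  have hlim : ∀ i j, 0 < μ i → 0 < μ j := by
    intro i j hi
    obtain ⟨c, hc, d, hcd⟩ := hP.exists_mul_nStep_le hirr i j
    exact (mul_pos hc hi).trans_le (le_of_tendsto_of_tendsto' ((hself i).const_mul c)
      ((tendsto_add_atTop_iff_nat d).2 (hself j)) hcd)
  refine ⟨μ, hμ, ?_, ?_, fun hrec => ?_⟩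
  · obtain ⟨i⟩ := ‹Nonempty ι›
    by_cases hi : 0 < μ i
    · exact Or.inr fun j => (hpos j).1 (hlim i j hi)
    · refine Or.inl ((hP.returnProb_lt_one_or_eq_one i).imp (fun h j => htrans j i h) ?_)
      intro h j
      have hj : returnProb P j = 1 :=
        (hP.returnProb_lt_one_or_eq_one j).resolve_left fun hlt => (htrans i j hlt).ne h
      refine ⟨hj, ?_⟩
      by_contra hne
      exact hi (hlim j i ((hpos j).2 ⟨hj, lt_top_iff_ne_top.2 hne⟩))
  · intro h j
    refine le_antisymm (not_lt.1 fun hj => ?_) (h0 j)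
    obtain ⟨h1, h2⟩ := (hpos j).1 hj
    rcases h with h | h
    · exact (h j).ne h1
    · exact h2.ne (h j).2
  · have hp : ∀ j, 0 < μ j := fun j => (hpos j).2 (hrec j)
    have hs := hP.summable_limit hμ
    have hst := hP.limit_stationary hμ
    have h1 : ∑' i, μ i = 1 := by
      obtain ⟨i⟩ := ‹Nonempty ι›
      have := hP.stationary_eq_mul_limit h0 hs hst hμ i
      exact mul_right_cancel₀ (hp i).ne' (by rw [one_mul, ← this])
    have hs1 : HasSum μ 1 := h1 ▸ hs.hasSum
    refine ⟨hp, hs1, ⟨h0, hs1, fun j => ?_⟩, fun ν hν => funext fun j => ?_⟩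
    · have hsj : Summable fun i => μ i * P i j :=
        summable_weight_mul h0 hs fun i => hP.abs_le_one i j
      exact hst j ▸ hsj.hasSum
    · have := hP.stationary_eq_mul_limit hν.nonneg hν.hasSum_one.summable
        (fun j => (hν.stationary j).tsum_eq) hμ j
      rwa [hν.hasSum_one.tsum_eq, one_mul] at this

end IsStochastic

/-! ### The emulation chain -/

theorem Computer.after_nil (C : Computer) : C.after [] = C := rfl

theorem Computer.after_after (C : Computer) (x y : List Bool) :
    (C.after x).after y = C.after (x ++ y) :=
  Subtype.ext (funext fun s => congrArg C.1 (List.append_assoc x y s).symm)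

open Classical in
theorem pathProb_append_singleton (Φ : Set Computer) (C : Computer) (x : List Bool) (b : Bool) :
    pathProb Φ C (x ++ [b]) =
      if x ++ [b] ∈ tree Φ C then
        if x ++ [!b] ∈ tree Φ C then 1 / 2 * pathProb Φ C x else pathProb Φ C x
      else 0 := by
  simp [pathProb, pathProbRev]

theorem mem_tree_after (Φ : Set Computer) (C : Computer) (x y : List Bool) :
    y ∈ tree Φ (C.after x) ↔ x ++ y ∈ tree Φ C := by
  simp only [tree, Set.mem_ofPred_eq, Computer.after_after]

theorem pathProb_append (Φ : Set Computer) (C : Computer) (x y : List Bool) :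
    pathProb Φ C (x ++ y) = pathProb Φ C x * pathProb Φ (C.after x) y := by
  classical
  induction y using List.reverseRecOn with
  | nil => simp [pathProb_nil]
  | append_singleton y b ih =>
    rw [← List.append_assoc, pathProb_append_singleton, pathProb_append_singleton, ih]
    simp only [mem_tree_after, List.append_assoc]
    split_ifs <;> ring

theorem pathProb_nonneg (Φ : Set Computer) (C : Computer) (x : List Bool) :
    0 ≤ pathProb Φ C x := by
  classical
  induction x using List.reverseRecOn with
  | nil => simp [pathProb_nil]
  | append_singleton x b ih =>
    rw [pathProb_append_singleton]
    split_ifs <;> positivity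

open Classical in
theorem pathProb_singleton (Φ : Set Computer) (C : Computer) (b : Bool) :
    pathProb Φ C [b] =
      if C.after [b] ∈ Φ then if C.after [!b] ∈ Φ then 1 / 2 else 1 else 0 := by
  simpa [pathProb_nil, tree] using pathProb_append_singleton Φ C [] b

/-- Prefix-closedness turns the nonempty input staying in `Φ` into a first bit staying in `Φ`, so
the root has a child. -/
theorem sum_pathProb_singleton {Φ : Set Computer} (hΦ : Branching Φ) {C : Computer}
    (hC : C ∈ Φ) : ∑ b, pathProb Φ C [b] = 1 := by
  classical
  obtain ⟨hpre, x, hx, hxΦ⟩ := hΦ C hC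
  obtain ⟨b, t, rfl⟩ := List.exists_cons_of_ne_nil hx
  have hb : C.after [b] ∈ Φ := hpre [b] t hxΦ
  rw [Fintype.sum_bool, pathProb_singleton, pathProb_singleton]
  cases b <;> simp only [Bool.not_true, Bool.not_false, hb, if_true] <;> split_ifs <;> norm_num

open Classical in
theorem stepProb_zero (Φ : Set Computer) (C D : Computer) :
    stepProb Φ 0 C D = if C = D then 1 else 0 := by
  rw [stepProb, Finset.sum_filter, Fintype.sum_unique]
  simp [emulates_iff, Computer.after_nil, pathProb_nil]

theorem stepProb_succ (Φ : Set Computer) (n : ℕ) (C D : Computer) :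
    stepProb Φ (n + 1) C D = ∑ b, pathProb Φ C [b] * stepProb Φ n (C.after [b]) D := by
  classical
  simp only [stepProb, Finset.sum_filter, Finset.mul_sum]
  rw [← Fintype.sum_prod_type', ← (Fin.consEquiv fun _ : Fin (n + 1) => Bool).sum_comp]
  refine Fintype.sum_congr _ _ fun x => ?_
  have h : List.ofFn (Fin.consEquiv (fun _ : Fin (n + 1) => Bool) x) =
      [x.1] ++ List.ofFn x.2 := List.ofFn_cons x.1 x.2
  rw [h, pathProb_append]
  simp only [emulates_iff, Computer.after_after, mul_ite, mul_zero]

theorem hasSum_emulationMatrix_mul (Φ : Set Computer) (C : Φ) (g : Computer → ℝ) :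
    HasSum (fun K : Φ => emulationMatrix Φ C K * g K.1)
      (∑ b, pathProb Φ C.1 [b] * g (C.1.after [b])) := by
  classical
  have h : ∀ K : Φ, emulationMatrix Φ C K * g K.1 =
      ∑ b, if C.1.after [b] = K.1 then pathProb Φ C.1 [b] * g K.1 else 0 := by
    intro K
    simp only [emulationMatrix, stepProb_succ, stepProb_zero, Finset.sum_mul, mul_ite, mul_one,
      mul_zero, ite_mul, zero_mul]
  simp only [h]
  refine hasSum_sum fun b _ => ?_
  by_cases hb : C.1.after [b] ∈ Φ
  · convert hasSum_ite_eq (⟨C.1.after [b], hb⟩ : Φ)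
      (pathProb Φ C.1 [b] * g (C.1.after [b])) using 2 with K
    by_cases hK : C.1.after [b] = K.1
    · rw [if_pos hK, if_pos (Subtype.ext hK.symm), hK]
    · rw [if_neg hK, if_neg fun h => hK (congrArg Subtype.val h).symm]
  -- A bit leading out of `Φ` has probability 0, so no mass is lost by summing over `Φ` only.
  · have h0 : pathProb Φ C.1 [b] = 0 := by rw [pathProb_singleton, if_neg hb]
    simp [h0, hasSum_zero]

theorem isStochastic_emulationMatrix {Φ : Set Computer} (hΦ : Branching Φ) :
    IsStochastic (emulationMatrix Φ) where
  nonneg _ _ := by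
    rw [emulationMatrix, stepProb]
    exact Finset.sum_nonneg fun _ _ => pathProb_nonneg _ _ _
  hasSum_row C := by
    have := hasSum_emulationMatrix_mul Φ C fun _ => 1
    simpa only [mul_one, sum_pathProb_singleton hΦ C.2] using this

/-- The Chapman–Kolmogorov equation: the `n`-step computer probabilities are the `n`-step
transition probabilities of the emulation matrix. -/
theorem nStep_emulationMatrix (Φ : Set Computer) (n : ℕ) (C D : Φ) :
    nStep (emulationMatrix Φ) n C D = stepProb Φ n C.1 D.1 := by
  classical
  induction n generalizing C with
  | zero => simp [nStep, stepProb_zero, Subtype.ext_iff]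
  | succ n ih =>
    simp only [nStep_succ, ih]
    rw [(hasSum_emulationMatrix_mul Φ C fun K => stepProb Φ n K D.1).tsum_eq, stepProb_succ]

end AlgProb

theorem theorem3p12 (Φ : Set AlgProb.Computer) (hne : Φ.Nonempty)
    (hbranch : AlgProb.Branching Φ) (hirr : AlgProb.Irreducible Φ)
    (haper : AlgProb.Aperiodic Φ) :
    ∃ μ : Φ → ℝ,
      (∀ C D : Φ, Tendsto (fun n : ℕ => AlgProb.stepProb Φ n C.1 D.1) atTop (𝓝 (μ D))) ∧
      ((AlgProb.IsTransient (AlgProb.emulationMatrix Φ) ∨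
          AlgProb.IsNullRecurrent (AlgProb.emulationMatrix Φ)) ∨
        AlgProb.IsPositiveRecurrent (AlgProb.emulationMatrix Φ)) ∧
      ((AlgProb.IsTransient (AlgProb.emulationMatrix Φ) ∨
          AlgProb.IsNullRecurrent (AlgProb.emulationMatrix Φ)) →
        ∀ D : Φ, μ D = 0) ∧
      (AlgProb.IsPositiveRecurrent (AlgProb.emulationMatrix Φ) →
        (∀ D : Φ, 0 < μ D) ∧ HasSum μ 1 ∧
        AlgProb.IsStationaryProbVector (AlgProb.emulationMatrix Φ) μ ∧
        ∀ ν : Φ → ℝ, AlgProb.IsStationaryProbVector (AlgProb.emulationMatrix Φ) ν → ν = μ) := by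
  have : Nonempty Φ := hne.to_subtype
  simp only [← AlgProb.nStep_emulationMatrix]
  refine (AlgProb.isStochastic_emulationMatrix hbranch).convergence (fun C D => ?_) fun C => ?_
  · simpa only [AlgProb.nStep_emulationMatrix] using hirr C.1 C.2 D.1 D.2
  · simp only [AlgProb.nStep_emulationMatrix]
    exact haper C.1 C.2
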